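/- Let $V$ be a finite set and $\mathcal L=\{x\in[0,\infty)^V:\|x\|_\infty>1\}$. Let $\boldsymbol Y=(Y_i)_{i\in V}$ be a random vector having a multivariate Pareto distribution with normalized margins, that is, $\boldsymbol Y\in\mathcal L$ almost surely, $\mathbb P(\boldsymbol Y\in tA)=t^{-1}\,\mathbb P(\boldsymbol Y\in A)$ for all $t\ge 1$ and all Borel sets $A\subset\mathcal L$, and the probability $\mathbb P(Y_i>1)$ is the same for all $i\in V$ (hence it is positive). For $m\in V$ let $\boldsymbol Y^m$ denote $\boldsymbol Y$ conditioned on the event $\{Y_m>1\}$. Let $T=(V,E)$ be a tree, and suppose that $\boldsymbol Y$ is an extremal graphical model on $T$: whenever $A,B,C\subset V$ are pairwise disjoint and every path in $T$ from $A$ to $C$ contains a node of $B$, the vectors $\boldsymbol Y^m_A$ and $\boldsymbol Y^m_C$ are conditionally independent given $\boldsymbol Y^m_B$, for every $m\in V$. Suppose that for every $m\in V$ the extremal variogram rooted at $m$, $$\Gamma^{(m)}_{ij}=\operatorname{Var}\{\log Y^m_i-\log Y^m_j\},\qquad i,j\in V,$$ exists, that is, for all $i,j\in V$ one has $Y^m_i,Y^m_j>0$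 almost surely and $\log Y^m_i-\log Y^m_j$ is square integrable. Suppose moreover that $\mathbb P(Y_i\ne Y_j)>0$ for all $i\neq j$ in $V$. Let $w_m\ge 0$, $m\in V$, with $\max_{m\in V}w_m>0$, and put $\rho_{ij}=\sum_{m\in V}w_m\Gamma^{(m)}_{ij}$. Then the minimum spanning tree with weights $\rho_{ij}$, that is, the minimizer of $\sum_{\{i,j\}\in E'}\rho_{ij}$ over all trees $T'=(V,E')$ with node set $V$, exists, is unique, and equals $T$. -/

import Mathlib

open MeasureTheory ProbabilityTheory
open scoped Pointwise

namespace ExtremalTree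

noncomputable section

/-- The set `𝓛 = {x ≥ 0 : ‖x‖_∞ > 1}` (the norm on `V → ℝ` is the sup norm). -/
def exceedanceSet (V : Type*) [Fintype V] : Set (V → ℝ) :=
  {x | 0 ≤ x ∧ 1 < ‖x‖}

/-- `μ` is a multivariate Pareto distribution with normalized margins: a probability measure
supported on `𝓛`, homogeneous in the sense that `μ (t A) = t⁻¹ μ A` for `t ≥ 1` and Borel `A ⊆ 𝓛`,
whose coordinates all have the same exceedance probability `μ {x | x i > 1}`.  (This common
probability is automatically positive, and equals `1 / ℓ(1, …, 1)` for the associated stable tail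
dependence function `ℓ`, whose normalization `ℓ(eᵢ) = 1` is the last field.) -/
structure IsMultivariatePareto {V : Type*} [Fintype V] (μ : Measure (V → ℝ)) : Prop where
  isProbabilityMeasure : IsProbabilityMeasure μ
  ae_mem : ∀ᵐ x ∂μ, x ∈ exceedanceSet V
  homogeneous : ∀ t : ℝ, 1 ≤ t → ∀ A : Set (V → ℝ), MeasurableSet A → A ⊆ exceedanceSet V →
    μ (t • A) = ENNReal.ofReal t⁻¹ * μ A
  margins : ∀ i j : V, μ {x | 1 < x i} = μ {x | 1 < x j}

/-- The law of `Y^m`, that is, of `Y` conditioned on `Y_m > 1`, where `μ` is the law of `Y`. -/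
def exceedanceLaw {V : Type*} (μ : Measure (V → ℝ)) (m : V) : Measure (V → ℝ) :=
  cond μ {x | 1 < x m}

instance {V : Type*} (μ : Measure (V → ℝ)) (m : V) : IsFiniteMeasure (exceedanceLaw μ m) := by
  unfold exceedanceLaw
  infer_instance

/-- The coordinate projection `x ↦ x_A`. -/
def proj {V : Type*} (A : Set V) (x : V → ℝ) : A → ℝ := fun i => x i

theorem measurable_proj {V : Type*} (A : Set V) : Measurable (proj A) :=
  measurable_pi_lambda _ fun i => measurable_pi_apply (i : V)

/-- Extremal conditional independence `Y_A ⊥_e Y_C | Y_B`: for every `m`, the vectors `Y^m_A` and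
`Y^m_C` are conditionally independent given `Y^m_B`. -/
def ExtremalCondIndep {V : Type*} [Fintype V] (μ : Measure (V → ℝ)) (A C B : Set V) : Prop :=
  ∀ m : V, CondIndepFun (MeasurableSpace.comap (proj B) inferInstance)
    (measurable_proj B).comap_le (proj A) (proj C) (exceedanceLaw μ m)

/-- `B` separates `A` and `C` in `G`: every path from `A` to `C` contains a node of `B`. -/
def Separates {V : Type*} (G : SimpleGraph V) (A C B : Set V) : Prop :=
  ∀ a ∈ A, ∀ c ∈ C, ∀ p : G.Walk a c, p.IsPath → ∃ b ∈ p.support, b ∈ B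

/-- `μ` is (the law of) an extremal graphical model on `G`: a multivariate Pareto distribution with
the global Markov property on `G` for extremal conditional independence. -/
structure IsExtremalGraphicalModel {V : Type*} [Fintype V] (μ : Measure (V → ℝ))
    (G : SimpleGraph V) : Prop where
  isMultivariatePareto : IsMultivariatePareto μ
  globalMarkov : ∀ A B C : Set V, Disjoint A B → Disjoint A C → Disjoint B C →
    Separates G A C B → ExtremalCondIndep μ A C B

/-- The extremal variogram matrix rooted at `m` exists: for all `i, j`, the variable
`log Y^m_i - log Y^m_j` is a.s. well defined and finite (`Y^m_i, Y^m_j > 0` a.s.; recall that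
`Real.log 0 = 0` by convention) and square integrable. -/
def VariogramExists {V : Type*} (μ : Measure (V → ℝ)) (m : V) : Prop :=
  ∀ i j : V, (∀ᵐ x ∂(exceedanceLaw μ m), 0 < x i ∧ 0 < x j) ∧
    MemLp (fun x : V → ℝ => Real.log (x i) - Real.log (x j)) 2 (exceedanceLaw μ m)

/-- The extremal variogram `Γ^{(m)}_{ij} = Var (log Y^m_i - log Y^m_j)`. -/
def variogram {V : Type*} (μ : Measure (V → ℝ)) (m i j : V) : ℝ :=
  variance (fun x : V → ℝ => Real.log (x i) - Real.log (x j)) (exceedanceLaw μ m)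

theorem variogram_comm {V : Type*} (μ : Measure (V → ℝ)) (m i j : V) :
    variogram μ m i j = variogram μ m j i := by
  unfold variogram
  rw [← variance_neg]
  congr 1
  ext x
  simp

/-- The weight `∑ₘ wₘ Γ^{(m)}_{ij}` of the unordered pair `{i, j}`. -/
def weightedVariogram {V : Type*} [Fintype V] (μ : Measure (V → ℝ)) (w : V → ℝ) : Sym2 V → ℝ :=
  Sym2.lift ⟨fun i j => ∑ m, w m * variogram μ m i j, fun i j => by
    simp only [variogram_comm μ _ i j]⟩

open Classical in
/-- The total weight of the edges of `T`, each undirected edge being counted once. -/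
def totalWeight {V : Type*} [Fintype V] (ρ : Sym2 V → ℝ) (T : SimpleGraph V) : ℝ :=
  ∑ e ∈ T.edgeFinset, ρ e

/-- `T` is a minimum spanning tree on the node set `V` for the weights `ρ`: a tree on `V` of
minimal total weight among all trees on `V`. -/
def IsMinimumSpanningTree {V : Type*} [Fintype V] (ρ : Sym2 V → ℝ) (T : SimpleGraph V) : Prop :=
  T.IsTree ∧ ∀ T' : SimpleGraph V, T'.IsTree → totalWeight ρ T ≤ totalWeight ρ T'

end

end ExtremalTree

/-! The weight turns out to be strictly positive on the edges of `T` and additive along the paths of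
`T`; any such weight has `T` as its only minimum spanning tree (`isMinimumSpanningTree_iff_eq`).

Additivity reduces to independence of log increments (`exceedanceLaw_logDiff_inter`). Under `Y^k`,
homogeneity makes `log Y_j - log Y_k` independent of `Y_k`. If `k` separates `j` from `i` and `m`,
the Markov property upgrades this to independence from `(Y_k, Y_i, Y_m)` jointly. Homogeneity then
carries the product formula from the root `k` to the root `m`: scaling by `t` turns `{x_m > t, x_k >
1}` into `{x_m > 1, x_k > 1/t}`, and `t → ∞` removes the constraint on `x_k`, which is positive
almost surely.

For positivity on an edge, a vanishing variogram would make the log ratio of its ends constant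
almost surely. Equal margins force this constant to be zero, so the two coordinates would agree
almost surely (`not_ae_logDiff_eq`). -/

namespace ExtremalTree

/-! ### Conditional independence. -/

/-- If `g` and `f` are conditionally independent given `Z`, and a function of `(Z, f)` is
independent of `Z`, then it is independent of `(Z, g)`. -/
theorem indepFun_prodMk_of_condIndepFun {Ω β β' γ δ : Type*} [MeasurableSpace Ω]
    [StandardBorelSpace Ω] [MeasurableSpace β] [StandardBorelSpace β] [Nonempty β]
    [MeasurableSpace β'] [StandardBorelSpace β'] [Nonempty β'] [MeasurableSpace γ]
    [MeasurableSpace δ] {μ : Measure Ω} [IsProbabilityMeasure μ]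
    {Z : Ω → γ} {f : Ω → β} {g : Ω → β'} (hZ : Measurable Z) (hf : Measurable f)
    (hg : Measurable g)
    (hci : CondIndepFun (MeasurableSpace.comap Z inferInstance) hZ.comap_le g f μ)
    {φ : γ × β → δ} (hφ : Measurable φ) (hind : IndepFun (fun ω => φ (Z ω, f ω)) Z μ) :
    IndepFun (fun ω => φ (Z ω, f ω)) (fun ω => (Z ω, g ω)) μ := by
  -- Conditional independence as a disintegration: given `(Z, g)`, the law of `f` depends on `Z`
  -- alone.
  have hjoint := (condDistrib_ae_eq_iff_measure_eq_compProd _ hf.aemeasurable _).1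
    ((condIndepFun_iff_condDistrib_prod_ae_eq_prodMkRight hf hg hZ).1 hci)
  have hZf := compProd_map_condDistrib (mβ := inferInstance) (X := Z) (μ := μ)
    hf.aemeasurable
  rw [indepFun_iff_measure_inter_preimage_eq_mul] at hind ⊢
  intro F H hF hH
  have hS : MeasurableSet (φ ⁻¹' F) := hφ hF
  have hsec : ∀ z : γ, MeasurableSet {b | φ (z, b) ∈ F} := fun z => measurable_prodMk_left hS
  have hmeas : Measurable fun z => condDistrib f Z μ z (Prod.mk z ⁻¹' (φ ⁻¹' F)) :=
    Kernel.measurable_kernel_prodMk_left hS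
  -- Independence of `φ (Z, f)` and `Z` says that the conditional probability of `φ (z, f) ∈ F`
  -- given `Z = z` does not depend on `z`.
  have key : (fun z => condDistrib f Z μ z (Prod.mk z ⁻¹' (φ ⁻¹' F))) =ᵐ[μ.map Z]
      fun _ => μ ((fun ω => φ (Z ω, f ω)) ⁻¹' F) := by
    have : IsProbabilityMeasure (μ.map Z) := Measure.isProbabilityMeasure_map hZ.aemeasurable
    refine ae_eq_of_forall_setLIntegral_eq_of_sigmaFinite hmeas measurable_const fun s hs _ => ?_
    have h1 := hind F s hF hs
    have h2 : μ ((fun ω => φ (Z ω, f ω)) ⁻¹' F ∩ Z ⁻¹' s) =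
        (μ.map fun x => (Z x, f x)) (φ ⁻¹' F ∩ Prod.fst ⁻¹' s) := by
      rw [Measure.map_apply (hZ.prodMk hf) (hS.inter (measurable_fst hs))]
      rfl
    rw [setLIntegral_const, Measure.map_apply hZ hs, ← h1, h2, ← hZf,
      Measure.compProd_apply (hS.inter (measurable_fst hs)), ← lintegral_indicator hs]
    refine lintegral_congr fun z => ?_
    by_cases hz : z ∈ s
    · rw [Set.indicator_of_mem hz]
      congr 1
      ext b
      simp [hz]
    · rw [Set.indicator_of_notMem hz]
      have : Prod.mk z ⁻¹' (φ ⁻¹' F ∩ Prod.fst ⁻¹' s) = (∅ : Set β) := by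
        ext b
        simp [hz]
      rw [this, measure_empty]
  have key' := ae_of_ae_map hZ.aemeasurable key
  have h3 : μ ((fun ω => φ (Z ω, f ω)) ⁻¹' F ∩ (fun ω => (Z ω, g ω)) ⁻¹' H) =
      (μ.map fun x => ((Z x, g x), f x))
        ((fun q : (γ × β') × β => (q.1.1, q.2)) ⁻¹' (φ ⁻¹' F) ∩ Prod.fst ⁻¹' H) := by
    rw [Measure.map_apply ((hZ.prodMk hg).prodMk hf)]
    · rfl
    · exact (MeasurableSet.preimage hS (by fun_prop)).inter (measurable_fst hH)
  have hH' : MeasurableSet ((fun ω => (Z ω, g ω)) ⁻¹' H) := hZ.prodMk hg hH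
  rw [h3, hjoint, Measure.compProd_apply
    ((MeasurableSet.preimage hS (by fun_prop)).inter (measurable_fst hH)),
    lintegral_map (Kernel.measurable_kernel_prodMk_left
      ((MeasurableSet.preimage hS (by fun_prop)).inter (measurable_fst hH))) (hZ.prodMk hg),
    ← setLIntegral_const, ← lintegral_indicator hH']
  refine lintegral_congr_ae ?_
  filter_upwards [key'] with ω hω
  by_cases hz : (Z ω, g ω) ∈ H
  · rw [Set.indicator_of_mem (by exact hz), ← hω, Kernel.prodMkRight_apply]
    congr 1
    ext b
    simp [hz]
  · rw [Set.indicator_of_notMem (by exact hz)]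
    have : Prod.mk (Z ω, g ω) ⁻¹' ((fun q : (γ × β') × β => (q.1.1, q.2)) ⁻¹' (φ ⁻¹' F) ∩
        Prod.fst ⁻¹' H) = (∅ : Set β) := by
      ext b
      simp [hz]
    rw [this, measure_empty]

/-! ### Homogeneity and change of root. -/

section Pareto

variable {V : Type*} {μ : Measure (V → ℝ)}

theorem measurableSet_one_lt (k : V) (a : ℝ) : MeasurableSet {x : V → ℝ | a < x k} :=
  measurableSet_lt measurable_const (measurable_pi_apply k)

/-- A set is scale invariant when its positive points are stable under positive scalings. -/
def ScaleInvariant (E : Set (V → ℝ)) : Prop :=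
  ∀ x : V → ℝ, (∀ i, 0 < x i) → ∀ t : ℝ, 0 < t → (t • x ∈ E ↔ x ∈ E)

theorem ScaleInvariant.inter {E E' : Set (V → ℝ)} (hE : ScaleInvariant E)
    (hE' : ScaleInvariant E') : ScaleInvariant (E ∩ E') := fun x hx t ht =>
  and_congr (hE x hx t ht) (hE' x hx t ht)

theorem scaleInvariant_univ : ScaleInvariant (Set.univ : Set (V → ℝ)) := fun _ _ _ _ => Iff.rfl

/-- The logarithmic increment `log x_j - log x_k`. -/
noncomputable def logDiff (j k : V) (x : V → ℝ) : ℝ := Real.log (x j) - Real.log (x k)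

theorem measurable_logDiff (j k : V) : Measurable (logDiff j k) :=
  (Real.measurable_log.comp (measurable_pi_apply j)).sub
    (Real.measurable_log.comp (measurable_pi_apply k))

theorem scaleInvariant_logDiff_preimage (j k : V) (F : Set ℝ) :
    ScaleInvariant (logDiff j k ⁻¹' F) := by
  intro x hx t ht
  have : logDiff j k (t • x) = logDiff j k x := by
    simp only [logDiff, Pi.smul_apply, smul_eq_mul]
    rw [Real.log_mul ht.ne' (hx j).ne', Real.log_mul ht.ne' (hx k).ne']
    ring
  rw [Set.mem_preimage, this, Set.mem_preimage]

theorem exceedanceLaw_apply (m : V) (s : Set (V → ℝ)) :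
    exceedanceLaw μ m s = (μ {x | 1 < x m})⁻¹ * μ ({x | 1 < x m} ∩ s) :=
  cond_apply (measurableSet_one_lt m 1) μ s

theorem measure_eq_iSup_inter_lt (hpos : ∀ᵐ x ∂μ, ∀ i, 0 < x i) (E : Set (V → ℝ)) (k : V) :
    μ E = ⨆ n : ℕ, μ (E ∩ {x | ((n : ℝ) + 1)⁻¹ < x k}) := by
  rw [← Monotone.measure_iUnion]
  · refine measure_congr ?_
    filter_upwards [hpos] with x hx
    refine propext ⟨fun hh => ?_, fun hh => ?_⟩
    · obtain ⟨n, hn⟩ := exists_nat_one_div_lt (hx k)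
      exact Set.mem_iUnion.2 ⟨n, hh, by simpa using hn⟩
    · obtain ⟨n, hn⟩ := Set.mem_iUnion.1 hh
      exact hn.1
  · intro a b hab
    refine Set.inter_subset_inter_right _ fun x hx => ?_
    rw [Set.mem_ofPred_eq] at hx ⊢
    refine lt_of_le_of_lt ?_ hx
    have : (a : ℝ) ≤ b := by exact_mod_cast hab
    gcongr

variable [Fintype V]

theorem exists_one_lt_of_mem_exceedanceSet {x : V → ℝ} (hx : x ∈ exceedanceSet V) :
    ∃ i, 1 < x i := by
  by_contra! h
  refine hx.2.not_ge ((pi_norm_le_iff_of_nonneg zero_le_one).2 fun i => ?_)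
  rw [Real.norm_of_nonneg (hx.1 i)]
  exact h i

theorem mem_exceedanceSet_of_one_lt {x : V → ℝ} (hx : 0 ≤ x) {i : V} (hi : 1 < x i) :
    x ∈ exceedanceSet V :=
  ⟨hx, hi.trans_le ((le_abs_self _).trans (norm_le_pi_norm x i))⟩

theorem IsMultivariatePareto.measure_one_lt_ne_zero (h : IsMultivariatePareto μ) (m : V) :
    μ {x | 1 < x m} ≠ 0 := by
  intro h0
  have := h.isProbabilityMeasure
  have hall : ∀ᵐ x ∂μ, ∀ i : V, ¬ 1 < x i := by
    refine ae_all_iff.2 fun i => ?_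
    rw [ae_iff]
    simpa [h.margins i m] using h0
  obtain ⟨x, hx, hx'⟩ := (hall.and h.ae_mem).exists
  obtain ⟨i, hi⟩ := exists_one_lt_of_mem_exceedanceSet hx'
  exact hx i hi

theorem IsMultivariatePareto.isProbabilityMeasure_exceedanceLaw (h : IsMultivariatePareto μ)
    (m : V) : IsProbabilityMeasure (exceedanceLaw μ m) := by
  have := h.isProbabilityMeasure
  exact cond_isProbabilityMeasure (h.measure_one_lt_ne_zero m)

/-- The events `{x | 1 < x m}` cover the support `𝓛`. -/
theorem IsMultivariatePareto.ae_of_forall_exceedanceLaw (h : IsMultivariatePareto μ)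
    {p : (V → ℝ) → Prop} (hp : ∀ m, ∀ᵐ x ∂(exceedanceLaw μ m), p x) : ∀ᵐ x ∂μ, p x := by
  have := h.isProbabilityMeasure
  have hall : ∀ᵐ x ∂μ, ∀ m : V, 1 < x m → p x := by
    refine ae_all_iff.2 fun m => ?_
    have h1 := hp m
    rw [ae_iff, exceedanceLaw_apply, mul_eq_zero] at h1
    rcases h1 with h1 | h1
    · exact absurd (ENNReal.inv_eq_zero.1 h1) (measure_ne_top _ _)
    · rw [ae_iff]
      convert h1 using 2
      ext x
      simp
  filter_upwards [hall, h.ae_mem] with x hx hx'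
  obtain ⟨i, hi⟩ := exists_one_lt_of_mem_exceedanceSet hx'
  exact hx i hi

theorem IsMultivariatePareto.ae_pos (h : IsMultivariatePareto μ)
    (hv : ∀ m : V, VariogramExists μ m) : ∀ᵐ x ∂μ, ∀ i, 0 < x i :=
  h.ae_of_forall_exceedanceLaw fun m => ae_all_iff.2 fun i =>
    (hv m i i).1.mono fun _ hx => hx.1

/-- Homogeneity for sets contained in a half-space `{x | 1 < x k}`. -/
theorem IsMultivariatePareto.measure_inv_smul_mem (h : IsMultivariatePareto μ) {t : ℝ}
    (ht : 1 ≤ t) {D : Set (V → ℝ)} (hD : MeasurableSet D) {k : V} (hDk : D ⊆ {x | 1 < x k}) :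
    μ {x | t⁻¹ • x ∈ D} = ENNReal.ofReal t⁻¹ * μ D := by
  have ht0 : 0 < t := zero_lt_one.trans_le ht
  have hnn : MeasurableSet {x : V → ℝ | 0 ≤ x} := measurableSet_Ici
  have h1 := h.homogeneous t ht (D ∩ {x | 0 ≤ x}) (hD.inter hnn)
    fun x hx => mem_exceedanceSet_of_one_lt hx.2 (hDk hx.1)
  have hD' : μ (D ∩ {x | 0 ≤ x}) = μ D := by
    refine measure_congr ?_
    filter_upwards [h.ae_mem] with x hx
    exact propext ⟨fun hh => hh.1, fun hh => ⟨hh, hx.1⟩⟩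
  rw [hD'] at h1
  rw [← h1]
  refine measure_congr ?_
  filter_upwards [h.ae_mem] with x hx
  refine propext ⟨fun hh => ?_, fun hh => ?_⟩
  · exact (Set.mem_smul_set_iff_inv_smul_mem₀ ht0.ne' _ _).2
      ⟨hh, smul_nonneg (inv_nonneg.2 ht0.le) hx.1⟩
  · exact ((Set.mem_smul_set_iff_inv_smul_mem₀ ht0.ne' _ _).1 hh).1

theorem measure_scaleInvariant_inter_lt (h : IsMultivariatePareto μ)
    (hpos : ∀ᵐ x ∂μ, ∀ i, 0 < x i) {E : Set (V → ℝ)} (hE : MeasurableSet E)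
    (hEs : ScaleInvariant E) (m : V) {t : ℝ} (ht : 1 ≤ t) :
    μ (E ∩ {x | t < x m}) = ENNReal.ofReal t⁻¹ * μ (E ∩ {x | 1 < x m}) := by
  have ht0 : 0 < t := zero_lt_one.trans_le ht
  rw [← h.measure_inv_smul_mem ht (hE.inter (measurableSet_one_lt m 1)) (k := m)
    Set.inter_subset_right]
  refine measure_congr ?_
  filter_upwards [hpos] with x hx
  refine propext (and_congr (hEs x hx _ (inv_pos.2 ht0)).symm ?_)
  simp only [Set.mem_ofPred_eq, Pi.smul_apply, smul_eq_mul]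
  rw [lt_inv_mul_iff₀ ht0, mul_one]

theorem measure_scaleInvariant_inter_lt_inter_one_lt (h : IsMultivariatePareto μ)
    (hpos : ∀ᵐ x ∂μ, ∀ i, 0 < x i) {E : Set (V → ℝ)} (hE : MeasurableSet E)
    (hEs : ScaleInvariant E) (m k : V) {t : ℝ} (ht : 1 ≤ t) :
    μ (E ∩ {x | t < x m} ∩ {x | 1 < x k}) =
      ENNReal.ofReal t⁻¹ * μ (E ∩ {x | 1 < x m} ∩ {x | t⁻¹ < x k}) := by
  have ht0 : 0 < t := zero_lt_one.trans_le ht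
  rw [← h.measure_inv_smul_mem ht ((hE.inter (measurableSet_one_lt m 1)).inter
    (measurableSet_one_lt k t⁻¹)) (k := m) fun x hx => hx.1.2]
  refine measure_congr ?_
  filter_upwards [hpos] with x hx
  refine propext (and_congr (and_congr (hEs x hx _ (inv_pos.2 ht0)).symm ?_) ?_)
  · simp only [Set.mem_ofPred_eq, Pi.smul_apply, smul_eq_mul]
    rw [lt_inv_mul_iff₀ ht0, mul_one]
  · simp only [Set.mem_ofPred_eq, Pi.smul_apply, smul_eq_mul]
    rw [lt_mul_iff_one_lt_right (inv_pos.2 ht0)]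

/-- Under `Y^k`, scale invariant functions are independent of the `k`-th coordinate. -/
theorem indepFun_of_scaleInvariant (h : IsMultivariatePareto μ)
    (hpos : ∀ᵐ x ∂μ, ∀ i, 0 < x i) {f : (V → ℝ) → ℝ} (hf : Measurable f)
    (hfs : ∀ F : Set ℝ, ScaleInvariant (f ⁻¹' F)) (k : V) :
    IndepFun f (fun x => x k) (exceedanceLaw μ k) := by
  have := h.isProbabilityMeasure
  have := h.isProbabilityMeasure_exceedanceLaw k
  set ν := exceedanceLaw μ k with hν
  have hk : Measurable fun x : V → ℝ => x k := measurable_pi_apply k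
  -- `Y^k` already satisfies `x k > 1`, so levels `s` below one act as one; hence `max s 1`.
  have hbase : ∀ F : Set ℝ, MeasurableSet F → ∀ s : ℝ,
      ν (f ⁻¹' F ∩ {x | s < x k}) = ENNReal.ofReal (max s 1)⁻¹ * ν (f ⁻¹' F) := by
    intro F hF s
    rw [hν, exceedanceLaw_apply, exceedanceLaw_apply]
    have h1 := measure_scaleInvariant_inter_lt h hpos (hf hF) (hfs F) k (le_max_right s 1)
    have h2 : {x : V → ℝ | 1 < x k} ∩ (f ⁻¹' F ∩ {x | s < x k}) =
        f ⁻¹' F ∩ {x | max s 1 < x k} := by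
      ext x
      simp only [Set.mem_inter_iff, Set.mem_ofPred_eq, max_lt_iff]
      tauto
    rw [h2, h1, Set.inter_comm]
    ring
  have hbase1 : ∀ s : ℝ, ν {x | s < x k} = ENNReal.ofReal (max s 1)⁻¹ := by
    intro s
    simpa using hbase Set.univ MeasurableSet.univ s
  rw [indepFun_iff_measure_inter_preimage_eq_mul]
  intro F S hF hS
  have hFm : MeasurableSet (f ⁻¹' F) := hf hF
  -- Two finite measures agreeing on the half-lines `Ioi s`, and in total mass, are equal.
  have heq : (ν.restrict (f ⁻¹' F)).map (fun x => x k) =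
      ν (f ⁻¹' F) • ν.map (fun x => x k) := by
    refine ext_of_generate_finite (Set.range Set.Ioi) (borel_eq_generateFrom_Ioi ℝ ▸
      BorelSpace.measurable_eq) isPiSystem_Ioi ?_ ?_
    · rintro _ ⟨s, rfl⟩
      rw [Measure.map_apply hk measurableSet_Ioi, Measure.restrict_apply (hk measurableSet_Ioi),
        Measure.smul_apply, Measure.map_apply hk measurableSet_Ioi, smul_eq_mul, Set.inter_comm]
      have h1 := hbase F hF s
      have h2 := hbase1 s
      rw [mul_comm, ← h2] at h1
      exact h1
    · rw [Measure.map_apply hk MeasurableSet.univ, Measure.smul_apply,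
        Measure.map_apply hk MeasurableSet.univ]
      simp
  have h3 := congrArg (fun ρ => ρ S) heq
  rw [Measure.map_apply hk hS, Measure.restrict_apply (hk hS), Measure.smul_apply,
    Measure.map_apply hk hS, smul_eq_mul, Set.inter_comm] at h3
  exact h3

/-- A product formula under `Y^k` for scale invariant events passes to `Y^m`. -/
theorem exceedanceLaw_inter_of_forall_lt (h : IsMultivariatePareto μ)
    (hpos : ∀ᵐ x ∂μ, ∀ i, 0 < x i) {E E' : Set (V → ℝ)} (hE : MeasurableSet E)
    (hE' : MeasurableSet E') (hEs : ScaleInvariant E) (hEs' : ScaleInvariant E') (m k : V)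
    (hprod : ∀ t : ℝ, exceedanceLaw μ k (E ∩ (E' ∩ {x | t < x m})) =
      exceedanceLaw μ k E * exceedanceLaw μ k (E' ∩ {x | t < x m})) :
    exceedanceLaw μ m (E ∩ E') = exceedanceLaw μ k E * exceedanceLaw μ m E' := by
  have := h.isProbabilityMeasure
  have hk0 := h.measure_one_lt_ne_zero k
  have hkt : μ {x | 1 < x k} ≠ ⊤ := measure_ne_top _ _
  -- Take `t = n + 1` in `hprod` and rescale: both sides acquire the same factor `t⁻¹`, which
  -- cancels.
  have key : ∀ n : ℕ, μ (E ∩ E' ∩ {x | 1 < x m} ∩ {x | ((n : ℝ) + 1)⁻¹ < x k}) =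
      exceedanceLaw μ k E * μ (E' ∩ {x | 1 < x m} ∩ {x | ((n : ℝ) + 1)⁻¹ < x k}) := by
    intro n
    have ht : (1 : ℝ) ≤ (n : ℝ) + 1 := by linarith [n.cast_nonneg (α := ℝ)]
    have ht0 : (0 : ℝ) < (n : ℝ) + 1 := by linarith
    have h1 := measure_scaleInvariant_inter_lt_inter_one_lt h hpos (hE.inter hE')
      (hEs.inter hEs') m k ht
    have h2 := measure_scaleInvariant_inter_lt_inter_one_lt h hpos hE' hEs' m k ht
    have h3 := hprod ((n : ℝ) + 1)
    rw [exceedanceLaw_apply k (E ∩ _), exceedanceLaw_apply k (E' ∩ _), ← mul_assoc,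
      mul_comm (exceedanceLaw μ k E), mul_assoc, ENNReal.mul_right_inj
        (ENNReal.inv_ne_zero.2 hkt) (ENNReal.inv_ne_top.2 hk0), Set.inter_comm, ← Set.inter_assoc,
      h1, Set.inter_comm {x : V → ℝ | 1 < x k}, h2, mul_left_comm, ENNReal.mul_right_inj
        (by simpa using ht0) ENNReal.ofReal_ne_top] at h3
    exact h3
  have h4 : μ (E ∩ E' ∩ {x | 1 < x m}) = exceedanceLaw μ k E * μ (E' ∩ {x | 1 < x m}) := by
    rw [measure_eq_iSup_inter_lt hpos _ k, measure_eq_iSup_inter_lt hpos (E' ∩ _) k,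
      ENNReal.mul_iSup]
    exact iSup_congr key
  rw [exceedanceLaw_apply m, exceedanceLaw_apply m, Set.inter_comm, h4, Set.inter_comm]
  ring

/-- Change of root with `E' = univ`: the product formula needed under `Y^k` reads `0 = 0`, so `E` is
null under every `Y^m`. -/
theorem measure_eq_zero_of_scaleInvariant (h : IsMultivariatePareto μ)
    (hpos : ∀ᵐ x ∂μ, ∀ i, 0 < x i) {E : Set (V → ℝ)} (hE : MeasurableSet E)
    (hEs : ScaleInvariant E) (k : V) (hEk : exceedanceLaw μ k E = 0) : μ E = 0 := by
  have hE0 : ∀ m, exceedanceLaw μ m E = 0 := by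
    intro m
    have h1 := exceedanceLaw_inter_of_forall_lt h hpos hE MeasurableSet.univ hEs
      scaleInvariant_univ m k fun t => by
        rw [hEk, zero_mul]
        exact measure_mono_null Set.inter_subset_left hEk
    simpa [hEk] using h1
  have := h.ae_of_forall_exceedanceLaw (p := fun x => x ∉ E) fun m => by
    rw [ae_iff]
    simpa using hE0 m
  rw [ae_iff] at this
  simpa using this

end Pareto

/-! ### Weights additive along the paths of a tree. -/

section MinimumSpanningTree

open Classical in
/-- The edges of `T` that lie on every path joining the two ends of `e`. -/
noncomputable def pathEdges {V : Type*} [Fintype V] (T : SimpleGraph V) (e : Sym2 V) :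
    Finset (Sym2 V) :=
  T.edgeFinset.filter fun d => ∀ u v, e = s(u, v) → ∀ p : T.Walk u v, p.IsPath → d ∈ p.edges

open Classical in
theorem pathEdges_eq {V : Type*} [Fintype V] {T : SimpleGraph V} (hT : T.IsTree) {u v : V}
    (p : T.Walk u v) (hp : p.IsPath) : pathEdges T s(u, v) = p.edges.toFinset := by
  ext d
  simp only [pathEdges, Finset.mem_filter, SimpleGraph.mem_edgeFinset, List.mem_toFinset]
  refine ⟨fun hd => hd.2 u v rfl p hp, fun hd => ⟨p.edges_subset_edgeSet hd, ?_⟩⟩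
  intro u' v' he q hq
  rcases Sym2.eq_iff.1 he with ⟨rfl, rfl⟩ | ⟨rfl, rfl⟩
  · rwa [(hT.existsUnique_path u v).unique hq hp]
  · rw [(hT.existsUnique_path v u).unique hq hp.reverse]
    simpa using hd

open Classical in
/-- If the weights are positive on the edges of a tree `T` and additive along the paths of `T`,
then `T` is the unique minimum spanning tree. -/
theorem isMinimumSpanningTree_iff_eq {V : Type*} [Fintype V] {T : SimpleGraph V} (hT : T.IsTree)
    {ρ : Sym2 V → ℝ} (hpos : ∀ e ∈ T.edgeSet, 0 < ρ e)
    (hadd : ∀ (u v : V) (p : T.Walk u v), p.IsPath → ρ s(u, v) = (p.edges.map ρ).sum)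
    (T' : SimpleGraph V) : IsMinimumSpanningTree ρ T' ↔ T' = T := by
  have hsum : ∀ e : Sym2 V, ρ e = ∑ d ∈ pathEdges T e, ρ d := by
    intro e
    induction e with | _ u v
    obtain ⟨p, hp, -⟩ := hT.existsUnique_path u v
    rw [pathEdges_eq hT p hp, hadd u v p hp, List.sum_toFinset ρ hp.isTrail.edges_nodup]
  have hsub : ∀ e, pathEdges T e ⊆ T.edgeFinset := fun e => Finset.filter_subset _ _
  -- Double counting: each edge of `S` is replaced by its path in `T`, and `d` is counted once for
  -- every path through it.
  have htotal : ∀ S : SimpleGraph V, totalWeight ρ S =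
      ∑ d ∈ T.edgeFinset, ((S.edgeFinset.filter fun e => d ∈ pathEdges T e).card : ℝ) * ρ d := by
    intro S
    unfold totalWeight
    calc ∑ e ∈ S.edgeFinset, ρ e
        = ∑ e ∈ S.edgeFinset, ∑ d ∈ T.edgeFinset, if d ∈ pathEdges T e then ρ d else 0 := by
          refine Finset.sum_congr rfl fun e _ => ?_
          rw [← Finset.sum_filter, Finset.filter_mem_eq_inter,
            Finset.inter_eq_right.2 (hsub e), ← hsum e]
      _ = _ := by
          rw [Finset.sum_comm]
          refine Finset.sum_congr rfl fun d _ => ?_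
          rw [← Finset.sum_filter, Finset.sum_const, nsmul_eq_mul]
  -- If no path used `d`, the ends of every edge of `S` would be joined in `T` without `d`; as `S`
  -- is connected, `d` would not be a bridge of `T`.
  have hcount : ∀ S : SimpleGraph V, S.IsTree → ∀ d ∈ T.edgeFinset,
      1 ≤ (S.edgeFinset.filter fun e => d ∈ pathEdges T e).card := by
    intro S hS d hd
    rw [Nat.one_le_iff_ne_zero, Ne, Finset.card_eq_zero, Finset.filter_eq_empty_iff]
    intro hcon
    have hd' := SimpleGraph.mem_edgeFinset.1 hd
    have hadj : ∀ u v, S.Adj u v → (T.deleteEdges {d}).Reachable u v := by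
      intro u v huv
      obtain ⟨p, hp, -⟩ := hT.existsUnique_path u v
      have h1 := hcon (SimpleGraph.mem_edgeFinset.2 ((SimpleGraph.mem_edgeSet S).2 huv))
      rw [pathEdges_eq hT p hp, List.mem_toFinset] at h1
      exact ⟨p.toDeleteEdge d h1⟩
    have hreach : ∀ u v, (T.deleteEdges {d}).Reachable u v := by
      intro u v
      obtain ⟨q⟩ := hS.connected.preconnected u v
      induction q with
      | nil => exact SimpleGraph.Reachable.refl _
      | cons h _ ih => exact (hadj _ _ h).trans ih
    have hbr := SimpleGraph.isAcyclic_iff_forall_isBridge.1 hT.isAcyclic hd'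
    induction d with | _ a b
    exact SimpleGraph.isBridge_iff.1 hbr (hreach a b)
  have hTtotal : totalWeight ρ T = ∑ d ∈ T.edgeFinset, ρ d := rfl
  have hle : ∀ S : SimpleGraph V, S.IsTree → totalWeight ρ T ≤ totalWeight ρ S := by
    intro S hS
    rw [hTtotal, htotal S]
    refine Finset.sum_le_sum fun d hd => ?_
    have h1 : (1 : ℝ) ≤ ((S.edgeFinset.filter fun e => d ∈ pathEdges T e).card : ℝ) := by
      exact_mod_cast hcount S hS d hd
    exact le_mul_of_one_le_left (hpos d (SimpleGraph.mem_edgeFinset.1 hd)).le h1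
  refine ⟨fun ⟨hT', hmin⟩ => ?_, fun h => h ▸ ⟨hT, hle⟩⟩
  have heq : ∑ d ∈ T.edgeFinset, ρ d = ∑ d ∈ T.edgeFinset,
      ((T'.edgeFinset.filter fun e => d ∈ pathEdges T e).card : ℝ) * ρ d := by
    rw [← htotal T', ← hTtotal]
    exact (hle T' hT').antisymm (hmin T hT)
  have hone : ∀ d ∈ T.edgeFinset,
      (T'.edgeFinset.filter fun e => d ∈ pathEdges T e).card = 1 := by
    intro d hd
    have h1 := (Finset.sum_eq_sum_iff_of_le fun d hd => ?_).1 heq d hd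
    · have hρ := hpos d (SimpleGraph.mem_edgeFinset.1 hd)
      have h2 : ((T'.edgeFinset.filter fun e => d ∈ pathEdges T e).card : ℝ) = 1 :=
        mul_right_cancel₀ hρ.ne' (by rw [← h1, one_mul])
      exact_mod_cast h2
    · have h1 : (1 : ℝ) ≤ ((T'.edgeFinset.filter fun e => d ∈ pathEdges T e).card : ℝ) := by
        exact_mod_cast hcount T' hT' d hd
      exact le_mul_of_one_le_left (hpos d (SimpleGraph.mem_edgeFinset.1 hd)).le h1
  have hcard : T'.edgeFinset.card = T.edgeFinset.card := by
    have h1 := hT.card_edgeFinset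
    have h2 := hT'.card_edgeFinset
    omega
  -- In the equality case the `T`-paths of the edges of `T'` have total length equal to the number
  -- of edges of `T'`. Each has length at least one, hence exactly one, so every edge of `T'` is an
  -- edge of `T`.
  have hlen : ∑ e ∈ T'.edgeFinset, (pathEdges T e).card = ∑ _e ∈ T'.edgeFinset, 1 := by
    calc ∑ e ∈ T'.edgeFinset, (pathEdges T e).card
        = ∑ e ∈ T'.edgeFinset, ∑ d ∈ T.edgeFinset, if d ∈ pathEdges T e then 1 else 0 := by
          refine Finset.sum_congr rfl fun e _ => ?_
          rw [← Finset.sum_filter, Finset.filter_mem_eq_inter,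
            Finset.inter_eq_right.2 (hsub e), Finset.card_eq_sum_ones]
      _ = ∑ d ∈ T.edgeFinset, 1 := by
          rw [Finset.sum_comm]
          refine Finset.sum_congr rfl fun d hd => ?_
          rw [← Finset.sum_filter, ← Finset.card_eq_sum_ones, hone d hd]
      _ = ∑ _e ∈ T'.edgeFinset, 1 := by simp [hcard]
  have hlenpos : ∀ e ∈ T'.edgeFinset, 1 ≤ (pathEdges T e).card := by
    intro e he
    induction e with | _ u v
    obtain ⟨p, hp, -⟩ := hT.existsUnique_path u v
    have huv : T'.Adj u v := by simpa using he
    rw [pathEdges_eq hT p hp, List.toFinset_card_of_nodup hp.isTrail.edges_nodup,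
      SimpleGraph.Walk.length_edges, Nat.one_le_iff_ne_zero]
    exact fun h0 => huv.ne (SimpleGraph.Walk.eq_of_length_eq_zero h0)
  have hlenone : ∀ e ∈ T'.edgeFinset, (pathEdges T e).card = 1 := fun e he =>
    ((Finset.sum_eq_sum_iff_of_le hlenpos).1 hlen.symm e he).symm
  have hsubset : T'.edgeFinset ⊆ T.edgeFinset := by
    intro e he
    have h1 := hlenone e he
    induction e with | _ u v
    obtain ⟨p, hp, -⟩ := hT.existsUnique_path u v
    rw [pathEdges_eq hT p hp, List.toFinset_card_of_nodup hp.isTrail.edges_nodup,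
      SimpleGraph.Walk.length_edges] at h1
    simpa using SimpleGraph.Walk.adj_of_length_eq_one h1
  exact SimpleGraph.edgeFinset_inj.1 (Finset.eq_of_subset_of_card_le hsubset hcard.ge)

end MinimumSpanningTree

/-! ### Variograms of the tree model. -/

section TreeModel

/-- Recovers the coordinate `i ∈ A ∪ {k}` from the vectors `x_{k}` and `x_A`. -/
noncomputable def coordOf {V : Type*} (k : V) (A : Set V) (i : V)
    (q : (({k} : Set V) → ℝ) × (A → ℝ)) : ℝ :=
  open Classical in if h : i ∈ A then q.2 ⟨i, h⟩ else q.1 ⟨k, rfl⟩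

theorem measurable_coordOf {V : Type*} (k : V) (A : Set V) (i : V) :
    Measurable (coordOf k A i) := by
  unfold coordOf
  by_cases h : i ∈ A
  · simp only [h, dite_true]
    exact (measurable_pi_apply _).comp measurable_snd
  · simp only [h, dite_false]
    exact (measurable_pi_apply _).comp measurable_fst

theorem coordOf_proj {V : Type*} {k i : V} {A : Set V} (hi : i ∈ A ∨ i = k) (x : V → ℝ) :
    coordOf k A i (proj {k} x, proj A x) = x i := by
  unfold coordOf
  by_cases h : i ∈ A
  · simp [h, proj]
  · simp [proj, hi.resolve_left h]

variable {V : Type*} [Fintype V] {μ : Measure (V → ℝ)} {T : SimpleGraph V}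

/-- If `k` separates `j` from `i` and from `m`, the increments `log Y_j - log Y_k` and
`log Y_i - log Y_k` are independent under `Y^m`, and the law of the former is that under `Y^k`. -/
theorem exceedanceLaw_logDiff_inter (hmodel : IsExtremalGraphicalModel μ T)
    (hpos : ∀ᵐ x ∂μ, ∀ i, 0 < x i) {i j k m : V} (hjk : j ≠ k)
    (hi : ∀ p : T.Walk i j, p.IsPath → k ∈ p.support)
    (hm : ∀ p : T.Walk m j, p.IsPath → k ∈ p.support) {F G : Set ℝ} (hF : MeasurableSet F)
    (hG : MeasurableSet G) :
    exceedanceLaw μ m (logDiff j k ⁻¹' F ∩ logDiff i k ⁻¹' G) =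
      exceedanceLaw μ k (logDiff j k ⁻¹' F) * exceedanceLaw μ m (logDiff i k ⁻¹' G) := by
  have h := hmodel.isMultivariatePareto
  have := h.isProbabilityMeasure_exceedanceLaw k
  -- The Markov property needs disjoint sets, but `i` or `m` may equal `k`; `coordOf` recovers that
  -- coordinate from `x_{k}`.
  set A : Set V := {i, m} \ {k} with hA
  have hself : ∀ a, (∀ p : T.Walk a j, p.IsPath → k ∈ p.support) → a ≠ j := by
    rintro a ha rfl
    have h1 := ha .nil .nil
    rw [SimpleGraph.Walk.support_nil, List.mem_singleton] at h1
    exact hjk h1.symm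
  have hmem : ∀ a ∈ A, ∀ p : T.Walk a j, p.IsPath → k ∈ p.support := by
    rintro a ⟨rfl | rfl, -⟩
    exacts [hi, hm]
  have hci : ExtremalCondIndep μ A {j} {k} := by
    refine hmodel.globalMarkov A {k} {j} Set.disjoint_sdiff_left ?_ ?_ ?_
    · exact Set.disjoint_singleton_right.2 fun hj => hself j (hmem j hj) rfl
    · exact Set.disjoint_singleton.2 hjk.symm
    · rintro a ha c rfl p hp
      exact ⟨k, hmem a ha p hp, rfl⟩
  have hiA : i ∈ A ∨ i = k := by
    by_cases hik : i = k
    · exact Or.inr hik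
    · exact Or.inl ⟨Or.inl rfl, hik⟩
  have hmA : m ∈ A ∨ m = k := by
    by_cases hmk : m = k
    · exact Or.inr hmk
    · exact Or.inl ⟨Or.inr rfl, hmk⟩
  have hind0 := indepFun_of_scaleInvariant h hpos (measurable_logDiff j k)
    (scaleInvariant_logDiff_preimage j k) k
  have hZ : Measurable fun y : ℝ => fun _ : ({k} : Set V) => y :=
    measurable_pi_lambda _ fun _ => measurable_id
  have hprojk : (fun y : ℝ => fun _ : ({k} : Set V) => y) ∘ (fun x : V → ℝ => x k) = proj {k} := by
    funext x ⟨a, ha⟩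
    obtain rfl := ha
    rfl
  have hind1 : IndepFun (logDiff j k) (proj {k}) (exceedanceLaw μ k) := by
    rw [← hprojk]
    exact hind0.comp measurable_id hZ
  have hφ : Measurable fun q : (({k} : Set V) → ℝ) × (({j} : Set V) → ℝ) =>
      Real.log (q.2 ⟨j, rfl⟩) - Real.log (q.1 ⟨k, rfl⟩) :=
    (Real.measurable_log.comp ((measurable_pi_apply _).comp measurable_snd)).sub
      (Real.measurable_log.comp ((measurable_pi_apply _).comp measurable_fst))
  have hind := indepFun_prodMk_of_condIndepFun (measurable_proj {k}) (measurable_proj {j})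
    (measurable_proj A) (hci k) hφ hind1
  rw [indepFun_iff_measure_inter_preimage_eq_mul] at hind
  refine exceedanceLaw_inter_of_forall_lt h hpos (measurable_logDiff j k hF)
    (measurable_logDiff i k hG) (scaleInvariant_logDiff_preimage j k F)
    (scaleInvariant_logDiff_preimage i k G) m k fun t => ?_
  have hH : MeasurableSet {q : (({k} : Set V) → ℝ) × (A → ℝ) |
      Real.log (coordOf k A i q) - Real.log (coordOf k A k q) ∈ G ∧ t < coordOf k A m q} :=
    (((Real.measurable_log.comp (measurable_coordOf k A i)).sub
      (Real.measurable_log.comp (measurable_coordOf k A k))) hG).inter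
      (measurableSet_lt measurable_const (measurable_coordOf k A m))
  -- The event is determined by `(x_k, x_A)`, so `hind` applies to it at every level `t`.
  have heq : (logDiff i k ⁻¹' G ∩ {x | t < x m} : Set (V → ℝ)) =
      (fun x => (proj {k} x, proj A x)) ⁻¹' {q : (({k} : Set V) → ℝ) × (A → ℝ) |
      Real.log (coordOf k A i q) - Real.log (coordOf k A k q) ∈ G ∧ t < coordOf k A m q} := by
    ext x
    simp only [Set.mem_preimage, Set.mem_inter_iff, Set.mem_ofPred_eq, coordOf_proj hiA,
      coordOf_proj hmA, coordOf_proj (Or.inr rfl : k ∈ A ∨ k = k), logDiff]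
  rw [heq]
  exact hind F _ hF hH

theorem variogram_self {V : Type*} {μ : Measure (V → ℝ)} (m i : V) :
    variogram μ m i i = 0 := by
  simp only [variogram, sub_self]
  exact variance_zero (exceedanceLaw μ m)

/-- The variogram is additive at a node separating the root and one end from the other end. -/
theorem variogram_add_of_separates (hmodel : IsExtremalGraphicalModel μ T)
    (hv : ∀ m : V, VariogramExists μ m) {i j k m : V} (hjk : j ≠ k)
    (hi : ∀ p : T.Walk i j, p.IsPath → k ∈ p.support)
    (hm : ∀ p : T.Walk m j, p.IsPath → k ∈ p.support) :
    variogram μ m i j = variogram μ m i k + variogram μ m k j := by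
  have h := hmodel.isMultivariatePareto
  have := h.isProbabilityMeasure_exceedanceLaw m
  have hpos := h.ae_pos hv
  have hmarg : ∀ F, MeasurableSet F →
      exceedanceLaw μ m (logDiff j k ⁻¹' F) = exceedanceLaw μ k (logDiff j k ⁻¹' F) := by
    intro F hF
    simpa using exceedanceLaw_logDiff_inter hmodel hpos hjk hi hm hF MeasurableSet.univ
  have hind : IndepFun (logDiff j k) (logDiff i k) (exceedanceLaw μ m) := by
    rw [indepFun_iff_measure_inter_preimage_eq_mul]
    intro F G hF hG
    rw [hmarg F hF]
    exact exceedanceLaw_logDiff_inter hmodel hpos hjk hi hm hF hG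
  have hind' : IndepFun (logDiff i k) (logDiff k j) (exceedanceLaw μ m) := by
    have h1 := hind.symm.comp measurable_id measurable_neg
    have h2 : Neg.neg ∘ logDiff j k = logDiff k j := by
      funext x
      simp [logDiff]
    rwa [h2] at h1
  have hsum := hind'.variance_add (hv m i k).2 (hv m k j).2
  have hfun : logDiff i k + logDiff k j =
      fun x : V → ℝ => Real.log (x i) - Real.log (x j) := by
    funext x
    simp [logDiff]
  rw [variogram, ← hfun]
  exact hsum

/-- The variogram is additive at any node separating its two arguments. -/
theorem variogram_add (hmodel : IsExtremalGraphicalModel μ T)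
    (hv : ∀ m : V, VariogramExists μ m) {i j k : V} (m : V) (hik : i ≠ k) (hjk : j ≠ k)
    (hsep : ∀ p : T.Walk i j, p.IsPath → k ∈ p.support) :
    variogram μ m i j = variogram μ m i k + variogram μ m k j := by
  classical
  by_cases hm : ∀ p : T.Walk m j, p.IsPath → k ∈ p.support
  · exact variogram_add_of_separates hmodel hv hjk hsep hm
  -- A walk from `m` to `j` avoids `k`. A walk from `m` to `i` avoiding `k` would join with it to
  -- connect `i` to `j` off `k`; so `k` separates `m` from `i`, and `i`, `j` exchange roles.
  · push Not at hm
    obtain ⟨q, -, hqk⟩ := hm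
    have hm' : ∀ p : T.Walk m i, p.IsPath → k ∈ p.support := by
      intro p _
      by_contra hpk
      have h1 := hsep (p.reverse.append q).toPath (p.reverse.append q).toPath.2
      have h2 := SimpleGraph.Walk.support_toPath_subset_support _ h1
      rw [SimpleGraph.Walk.mem_support_append_iff, SimpleGraph.Walk.support_reverse,
        List.mem_reverse] at h2
      exact h2.elim hpk hqk
    have hsep' : ∀ p : T.Walk j i, p.IsPath → k ∈ p.support := by
      intro p hp
      simpa using hsep p.reverse hp.reverse
    rw [variogram_comm μ m i j, variogram_add_of_separates hmodel hv hik hsep' hm',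
      variogram_comm μ m j k, variogram_comm μ m k i, add_comm]

/-- If `x t = exp c * x s` with `c > 0`, then `{x s > 1}` lies in `{x t > exp c}`, whose mass is
`exp (-c)` times that of `{x t > 1}`; equal positive margins forbid this. Exchanging `s` and `t`
excludes `c < 0`, and `c = 0` contradicts `hne`. -/
theorem not_ae_logDiff_eq (hmodel : IsExtremalGraphicalModel μ T)
    (hv : ∀ m : V, VariogramExists μ m) {s t : V} (hne : ¬ ∀ᵐ x ∂μ, x s = x t) (c : ℝ) :
    ¬ ∀ᵐ x ∂μ, logDiff t s x = c := by
  have h := hmodel.isMultivariatePareto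
  have := h.isProbabilityMeasure
  have hpos := h.ae_pos hv
  have key : ∀ (s t : V) (c : ℝ), (∀ᵐ x ∂μ, logDiff t s x = c) → ¬ 0 < c := by
    intro s t c hc hc0
    have hexp : (1 : ℝ) < Real.exp c := Real.one_lt_exp_iff.2 hc0
    have hle : μ {x | 1 < x s} ≤ μ {x | Real.exp c < x t} := by
      refine measure_mono_ae ?_
      filter_upwards [hpos, hc] with x hx hxc hs
      have hs' : 1 < x s := hs
      have h1 : Real.log (x t) = c + Real.log (x s) := by
        rw [← hxc, logDiff]
        ring
      have h2 : x t = Real.exp c * x s := by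
        rw [← Real.exp_log (hx t), h1, Real.exp_add, Real.exp_log (hx s)]
      change Real.exp c < x t
      rw [h2]
      exact lt_mul_of_one_lt_right (Real.exp_pos c) hs'
    have hscale := measure_scaleInvariant_inter_lt h hpos MeasurableSet.univ
      scaleInvariant_univ t hexp.le
    rw [Set.univ_inter, Set.univ_inter] at hscale
    rw [hscale, h.margins s t] at hle
    have hlt : ENNReal.ofReal (Real.exp c)⁻¹ < 1 :=
      ENNReal.ofReal_lt_one.2 (inv_lt_one_of_one_lt₀ hexp)
    have := ENNReal.mul_lt_mul_left (h.measure_one_lt_ne_zero t) (measure_ne_top μ _) hlt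
    rw [one_mul] at this
    exact (hle.trans_lt this).false
  intro hc
  have h1 := key s t c hc
  have h2 := key t s (-c) (by
    filter_upwards [hc] with x hx
    rw [← hx, logDiff, logDiff]
    ring)
  have hc0 : c = 0 := by linarith
  refine hne ?_
  filter_upwards [hpos, hc] with x hx hxc
  rw [hc0, logDiff, sub_eq_zero] at hxc
  exact (Real.log_injOn_pos (hx t) (hx s) hxc).symm

theorem variogram_pos_of_separates (hmodel : IsExtremalGraphicalModel μ T)
    (hv : ∀ m : V, VariogramExists μ m) {s t m : V} (hts : t ≠ s)
    (hne : ¬ ∀ᵐ x ∂μ, x s = x t) (hm : ∀ p : T.Walk m t, p.IsPath → s ∈ p.support) :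
    0 < variogram μ m t s := by
  have h := hmodel.isMultivariatePareto
  have hpos := h.ae_pos hv
  have := h.isProbabilityMeasure_exceedanceLaw m
  refine lt_of_le_of_ne (variance_nonneg _ _) fun h0 => ?_
  have hc := ae_eq_integral_of_variance_eq_zero (hv m t s).2 h0.symm
  set c := ∫ x, (Real.log (x t) - Real.log (x s)) ∂(exceedanceLaw μ m) with hcdef
  have hnull : exceedanceLaw μ m (logDiff t s ⁻¹' {c}ᶜ) = 0 := hc
  have hmeas : MeasurableSet ({c}ᶜ : Set ℝ) := (measurableSet_singleton c).compl
  -- The increment has the same law under `Y^m` and `Y^s`, so it is constant under `Y^s` too; scale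
  -- invariance extends this to `μ`.
  have htrans := exceedanceLaw_logDiff_inter hmodel hpos hts hm hm hmeas MeasurableSet.univ
  simp only [Set.preimage_univ, Set.inter_univ, measure_univ, mul_one] at htrans
  rw [hnull] at htrans
  have hzero : μ (logDiff t s ⁻¹' {c}ᶜ) = 0 := measure_eq_zero_of_scaleInvariant h hpos
    (measurable_logDiff t s hmeas) (scaleInvariant_logDiff_preimage t s _) s htrans.symm
  exact not_ae_logDiff_eq hmodel hv hne c hzero

/-- For an edge of a tree, one end lies on the path from the root `m` to the other end. -/
theorem variogram_pos_of_adj (hT : T.IsTree) (hmodel : IsExtremalGraphicalModel μ T)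
    (hv : ∀ m : V, VariogramExists μ m) {s t : V} (m : V) (hadj : T.Adj s t)
    (hne : ¬ ∀ᵐ x ∂μ, x s = x t) : 0 < variogram μ m s t := by
  by_cases hm : ∀ p : T.Walk m t, p.IsPath → s ∈ p.support
  · rw [variogram_comm]
    exact variogram_pos_of_separates hmodel hv hadj.ne' hne hm
  · push Not at hm
    obtain ⟨q, hq, hqs⟩ := hm
    refine variogram_pos_of_separates hmodel hv hadj.ne (fun h => hne ?_) fun p hp =>
      hT.isAcyclic.mem_support_of_ne_mem_support_of_adj_of_isPath hp hq hadj hqs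
    filter_upwards [h] with x hx using hx.symm

theorem weightedVariogram_mk (w : V → ℝ) (i j : V) :
    weightedVariogram μ w s(i, j) = ∑ m, w m * variogram μ m i j := rfl

theorem weightedVariogram_path (hT : T.IsTree) (hmodel : IsExtremalGraphicalModel μ T)
    (hv : ∀ m : V, VariogramExists μ m) (w : V → ℝ) (u v : V) (p : T.Walk u v) (hp : p.IsPath) :
    weightedVariogram μ w s(u, v) = (p.edges.map (weightedVariogram μ w)).sum := by
  induction p with
  | nil => simp [weightedVariogram_mk, variogram_self]
  | @cons u k v hadj p ih =>
    have hp' := (SimpleGraph.Walk.cons_isPath_iff hadj p).1 hp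
    rw [SimpleGraph.Walk.edges_cons, List.map_cons, List.sum_cons, ← ih hp'.1]
    -- Additivity at `k` needs `v ≠ k`; otherwise the remaining path is closed and has weight zero.
    by_cases hkv : v = k
    · subst hkv
      simp [weightedVariogram_mk, variogram_self]
    · have hsep : ∀ q : T.Walk u v, q.IsPath → k ∈ q.support := by
        intro q hq
        rw [(hT.existsUnique_path u v).unique hq hp]
        simp
      simp only [weightedVariogram_mk, ← Finset.sum_add_distrib, ← mul_add]
      exact Finset.sum_congr rfl fun m _ => by
        rw [variogram_add hmodel hv m hadj.ne hkv hsep]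

end TreeModel

end ExtremalTree

/-! ### The minimum spanning tree of the model. -/

theorem mainTheorem7 {V : Type*} [Fintype V] {Ω : Type*} [MeasurableSpace Ω]
    (P : Measure Ω) [IsProbabilityMeasure P] (Y : Ω → V → ℝ) (hY : AEMeasurable Y P)
    (T : SimpleGraph V) (hT : T.IsTree)
    (hmodel : ExtremalTree.IsExtremalGraphicalModel (P.map Y) T)
    (hvario : ∀ m : V, ExtremalTree.VariogramExists (P.map Y) m)
    (hne : ∀ i j : V, i ≠ j → 0 < P {ω | Y ω i ≠ Y ω j})
    (w : V → ℝ) (hw : ∀ m, 0 ≤ w m) (hw_pos : ∃ m, 0 < w m) :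
    ∀ T' : SimpleGraph V,
      ExtremalTree.IsMinimumSpanningTree (ExtremalTree.weightedVariogram (P.map Y) w) T' ↔
        T' = T := by
  refine ExtremalTree.isMinimumSpanningTree_iff_eq hT (fun e he => ?_)
    (ExtremalTree.weightedVariogram_path hT hmodel hvario w)
  induction e with | _ s t
  have hadj : T.Adj s t := he
  have hst : ¬ ∀ᵐ x ∂(P.map Y), x s = x t := by
    intro h
    have h1 := ae_of_ae_map hY h
    exact (hne s t hadj.ne).ne' (ae_iff.1 h1)
  have hpos := fun m => ExtremalTree.variogram_pos_of_adj hT hmodel hvario m hadj hst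
  obtain ⟨m, hm⟩ := hw_pos
  rw [ExtremalTree.weightedVariogram_mk]
  exact Finset.sum_pos' (fun n _ => mul_nonneg (hw n) (hpos n).le)
    ⟨m, Finset.mem_univ m, mul_pos hm (hpos m)⟩
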